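/- Let $p$ be a prime and let $(B,\mathfrak m)$ be a complete noetherian regular local ring of dimension $d\ge 1$ and characteristic $p$, and let $k\subset B$ be a coefficient field, i.e. a subfield that maps isomorphically onto the residue field $B/\mathfrak m$; identify $k$ with $B/\mathfrak m$. Let $\theta:B\to B$ be a $k$-derivation such that (i) the $k$-linear map $\bar\theta:\mathfrak m/\mathfrak m^2\to k$, $x+\mathfrak m^2\mapsto\theta(x)+\mathfrak m$, is not zero, and (ii) $\theta^p=a\theta$ for some $a\in\mathrm{Frac}(B)$, where $\theta^p$ is the $p$-fold iterate of $\theta$. Then there exists a regular system of parameters $(x_1,\ldots,x_d)$ of $B$ (that is, $d$ generators of $\mathfrak m$) such that $\theta(x_1)\equiv 1\pmod{\mathfrak m}$ and $\theta(x_2)=\cdots=\theta(x_d)=0$. -/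

import Mathlib

/-!
Pick `y ∈ 𝔪` with `θ y` a unit and put `D = (θ y)⁻¹ θ`, so that `D y = 1`. Expanding
`θᵖ = ((θ y) D)ᵖ` gives `(θ y)ᵖ Dᵖ` plus a combination of lower powers of `D`, and `θᵖ` is itself a
multiple of `D`, so `Dᵖ` is a combination of lower powers of `D`. Testing on `1, y, …, yᵖ⁻¹` shows
that this combination is trivial, so `Dᵖ = 0`. Then every `b` is congruent modulo `y` to a constant
of `D`, obtained by successively subtracting terms `g yⁱ` of its Taylor expansion. Replacing the
other members of a regular system of parameters containing `y` by such constants, and `y` by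
`(θ y)⁻¹ y`, gives the required system.
-/

open IsLocalRing

noncomputable section

/-- For a derivation `θ : B → B` of a local ring `(B, 𝔪)`, the `B`-linear map `𝔪 → B/𝔪`,
`x ↦ θ x mod 𝔪`. It is `B`-linear since `θ (b x) = b θ x + x θ b ≡ b θ x mod 𝔪` for `x ∈ 𝔪`. -/
def derivMaximalIdeal {k B : Type*} [Field k] [CommRing B] [IsLocalRing B] [Algebra k B]
    (θ : Derivation k B B) : maximalIdeal B →ₗ[B] ResidueField B where
  toFun x := residue B (θ (x : B))
  map_add' x y := by simp
  map_smul' b x := by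
    have hx : residue B (x : B) = 0 := (residue_eq_zero_iff _).2 x.2
    simp [hx, Algebra.smul_def]

/-- The linear map `𝔪/𝔪² → B/𝔪` over the residue field induced by a derivation `θ : B → B` of a
local ring `(B, 𝔪)`; it sends the class of `x ∈ 𝔪` to the class of `θ x`. -/
def derivCotangentSpace {k B : Type*} [Field k] [CommRing B] [IsLocalRing B] [Algebra k B]
    (θ : Derivation k B B) : CotangentSpace B →ₗ[ResidueField B] ResidueField B :=
  LinearMap.extendScalarsOfSurjective (R := B) residue_surjective
    (Ideal.Cotangent.lift (derivMaximalIdeal θ) (by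
      intro x y
      have hx : residue B (x : B) = 0 := (residue_eq_zero_iff _).2 x.2
      have h : derivMaximalIdeal θ ((x : B) • y) = 0 := by
        rw [map_smul, Algebra.smul_def, ResidueField.algebraMap_eq, hx, zero_mul]
      exact h))

theorem derivCotangentSpace_toCotangent {k B : Type*} [Field k] [CommRing B] [IsLocalRing B]
    [Algebra k B] (θ : Derivation k B B) (x : maximalIdeal B) :
    derivCotangentSpace θ ((maximalIdeal B).toCotangent x) = residue B (θ (x : B)) :=
  rfl

/-- A family `(x₁, …, x_d)` of elements of a local ring `(B, 𝔪)` is a regular system of parameters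
if `d = dim B` and `x₁, …, x_d` generate `𝔪`. -/
structure IsRegularSystemOfParameters {B : Type*} [CommRing B] [IsLocalRing B] {d : ℕ}
    (x : Fin d → B) : Prop where
  ringKrullDim_eq : ringKrullDim B = d
  span_range_eq : Ideal.span (Set.range x) = maximalIdeal B

end

section Iterates

open scoped Nat

variable {k B : Type*} [CommRing k] [CommRing B] [Algebra k B] (D : Derivation k B B)

/-- The `B`-module of differential operators `∑ i < n, eᵢ Dⁱ` generated by the first `n` powers
`1, D, …, Dⁿ⁻¹` of a derivation `D`, inside the `k`-linear endomorphisms of `B`. -/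
def iterateSpan (n : ℕ) : Submodule B (Module.End k B) :=
  Submodule.span B ((fun i : ℕ => (D : Module.End k B) ^ i) '' Set.Iio n)

variable {D} in
theorem pow_mem_iterateSpan {i n : ℕ} (h : i < n) :
    (D : Module.End k B) ^ i ∈ iterateSpan D n :=
  Submodule.subset_span ⟨i, h, rfl⟩

theorem iterateSpan_mono : Monotone (iterateSpan D) := fun _ _ h =>
  Submodule.span_mono (Set.image_mono (Set.Iio_subset_Iio h))

variable {D} in
theorem mem_iterateSpan_succ {n : ℕ} {T : Module.End k B} :
    T ∈ iterateSpan D (n + 1) ↔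
      ∃ e : B, ∃ S ∈ iterateSpan D n, T = e • (D : Module.End k B) ^ n + S := by
  rw [iterateSpan, ← Order.succ_eq_add_one, Order.Iio_succ_eq_insert,
    Set.image_insert_eq, Submodule.mem_span_insert]
  rfl

theorem derivation_mul_smul (e : B) (T : Module.End k B) :
    (D : Module.End k B) * (e • T) = e • ((D : Module.End k B) * T) + D e • T := by
  ext b
  simp [mul_comm]

variable {D} in
theorem derivation_mul_mem_iterateSpan {n : ℕ} {T : Module.End k B} (hT : T ∈ iterateSpan D n) :
    (D : Module.End k B) * T ∈ iterateSpan D (n + 1) := by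
  induction hT using Submodule.span_induction with
  | mem _ h =>
    obtain ⟨i, hi, rfl⟩ := h
    simpa only [pow_succ'] using pow_mem_iterateSpan (D := D) (Nat.succ_lt_succ hi)
  | zero => simp
  | add S T _ _ hS hT => rw [mul_add]; exact add_mem hS hT
  | smul e T hT ih =>
    rw [derivation_mul_smul]
    exact add_mem (Submodule.smul_mem _ _ ih)
      (Submodule.smul_mem _ _ (iterateSpan_mono D n.le_succ hT))

theorem smul_derivation_pow_sub_mem_iterateSpan (u : B) (n : ℕ) :
    (u • (D : Module.End k B)) ^ n - u ^ n • (D : Module.End k B) ^ n ∈ iterateSpan D n := by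
  induction n with
  | zero => simp
  | succ n ih =>
    set E : Module.End k B := (D : Module.End k B)
    have expand : (u • E) ^ (n + 1) - u ^ (n + 1) • E ^ (n + 1) =
        u • (E * ((u • E) ^ n - u ^ n • E ^ n)) + (u * D (u ^ n)) • E ^ n := by
      rw [mul_sub, derivation_mul_smul, pow_succ' (u • E), pow_succ' E, pow_succ' u, smul_mul_assoc]
      module
    rw [expand]
    exact add_mem (Submodule.smul_mem _ _ (derivation_mul_mem_iterateSpan ih))
      (Submodule.smul_mem _ _ (pow_mem_iterateSpan n.lt_succ_self))

variable {D} {x : B}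

theorem derivation_pow_apply_pow (hx : D x = 1) (i j : ℕ) :
    ((D : Module.End k B) ^ i) (x ^ j) = (j.descFactorial i : B) * x ^ (j - i) := by
  induction i with
  | zero => simp
  | succ i ih =>
    rw [pow_succ', Module.End.mul_apply, ih, Derivation.coeFn_coe, D.leibniz, D.leibniz_pow, hx,
      D.map_natCast, Nat.descFactorial_succ, Nat.sub_sub]
    simp only [smul_eq_mul, nsmul_eq_mul]
    push_cast
    ring

theorem derivation_pow_apply_mul {c : B} (hc : D c = 0) (i : ℕ) (b : B) :
    ((D : Module.End k B) ^ i) (c * b) = c * ((D : Module.End k B) ^ i) b := by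
  induction i with
  | zero => simp
  | succ i ih => simp [pow_succ', ih, hc]

theorem eq_zero_of_mem_iterateSpan (hx : D x = 1) {n : ℕ} (hfac : IsUnit ((n - 1)! : B))
    {T : Module.End k B} (hT : T ∈ iterateSpan D n) (hTx : ∀ j < n, T (x ^ j) = 0) : T = 0 := by
  induction n generalizing T with
  | zero => simpa [iterateSpan] using hT
  | succ n ih =>
    obtain ⟨e, S, hS, rfl⟩ := mem_iterateSpan_succ.1 hT
    have hS0 : S = 0 := by
      refine ih (hfac.natCast_factorial_of_le (by omega)) hS fun j hj => ?_
      simpa [derivation_pow_apply_pow hx, Nat.descFactorial_of_lt hj] using hTx j (by omega)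
    have he : e * (n ! : B) = 0 := by
      simpa [hS0, derivation_pow_apply_pow hx, Nat.descFactorial_self] using hTx n n.lt_succ_self
    rw [hfac.mul_left_eq_zero.1 he, hS0, zero_smul, add_zero]

theorem derivation_pow_eq_zero_of_mem_iterateSpan (hx : D x = 1) {n : ℕ}
    (hfac : IsUnit ((n - 1)! : B)) (hD : (D : Module.End k B) ^ n ∈ iterateSpan D n) :
    (D : Module.End k B) ^ n = 0 :=
  eq_zero_of_mem_iterateSpan hx hfac hD fun j hj => by
    rw [derivation_pow_apply_pow hx, Nat.descFactorial_of_lt hj, Nat.cast_zero, zero_mul]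

theorem derivation_pow_eq_zero_of_smul_pow_eq_smul (hx : D x = 1) {u : B} (hu : IsUnit u) {n : ℕ}
    (hn : 1 < n) (hfac : IsUnit ((n - 1)! : B)) {c : B}
    (hc : (u • (D : Module.End k B)) ^ n = c • (D : Module.End k B)) :
    (D : Module.End k B) ^ n = 0 := by
  refine derivation_pow_eq_zero_of_mem_iterateSpan hx hfac ?_
  have hD : (D : Module.End k B) ∈ iterateSpan D n := by simpa using pow_mem_iterateSpan (D := D) hn
  rw [← (iterateSpan D n).smul_mem_iff_of_isUnit (hu.pow n),
    ← Submodule.sub_mem_iff_right _ ((iterateSpan D n).smul_mem c hD), ← hc]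
  exact smul_derivation_pow_sub_mem_iterateSpan D u n

theorem exists_apply_eq_zero_dvd_sub_of_pow_apply_eq_zero (hx : D x = 1) {n : ℕ}
    (hfac : IsUnit (n ! : B)) {b : B} (hb : ((D : Module.End k B) ^ (n + 1)) b = 0) :
    ∃ z, D z = 0 ∧ x ∣ b - z := by
  induction n generalizing b with
  | zero => exact ⟨b, by simpa using hb, by simp⟩
  | succ n ih =>
    set f := ((D : Module.End k B) ^ (n + 1)) b with hf
    have hDf : D f = 0 := by rwa [pow_succ', Module.End.mul_apply] at hb
    obtain ⟨g, hg⟩ : ((n + 1)! : B) ∣ f := hfac.dvd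
    have hDg : D g = 0 := by
      rw [hg, D.leibniz, D.map_natCast, smul_zero, add_zero] at hDf
      exact hfac.mul_right_eq_zero.1 hDf
    have hb' : ((D : Module.End k B) ^ (n + 1)) (b - g * x ^ (n + 1)) = 0 := by
      rw [map_sub, ← hf, hg, derivation_pow_apply_mul hDg, derivation_pow_apply_pow hx,
        Nat.descFactorial_self, Nat.sub_self]
      ring
    obtain ⟨z, hz, hxz⟩ := ih (hfac.natCast_factorial_of_le n.le_succ) hb'
    refine ⟨z, hz, ?_⟩
    rw [show b - z = b - g * x ^ (n + 1) - z + g * x ^ n * x by ring]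
    exact dvd_add hxz (dvd_mul_left _ _)

theorem exists_apply_eq_zero_dvd_sub_of_iterate_eq_mul {θ : Derivation k B B} {y : B}
    (hy : IsUnit (θ y)) {n : ℕ} (hn : 1 < n) (hfac : IsUnit ((n - 1)! : B)) {c : B}
    (hc : ∀ b, θ^[n] b = c * θ b) (b : B) : ∃ z, θ z = 0 ∧ y ∣ b - z := by
  obtain ⟨v, hv⟩ := hy.exists_left_inv
  have hDy : (v • θ) y = 1 := hv
  have hθ : (θ : Module.End k B) = θ y • ((v • θ : Derivation k B B) : Module.End k B) := by
    rw [Derivation.coe_smul_linearMap, smul_smul, mul_comm, hv, one_smul]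
  have hDn : ((v • θ : Derivation k B B) : Module.End k B) ^ n = 0 := by
    refine derivation_pow_eq_zero_of_smul_pow_eq_smul hDy hy hn hfac (c := c * θ y) ?_
    rw [mul_smul, ← hθ]
    ext b
    simpa [Module.End.pow_apply] using hc b
  obtain ⟨z, hz, hyz⟩ := exists_apply_eq_zero_dvd_sub_of_pow_apply_eq_zero (n := n - 1) hDy hfac
    (b := b) (by rw [Nat.sub_add_cancel hn.le, hDn, LinearMap.zero_apply])
  exact ⟨z, (IsUnit.of_mul_eq_one _ hv).mul_right_eq_zero.1 hz, hyz⟩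

end Iterates

theorem exists_eq_mul_of_map_eq_mul {ι A K : Type*} [CommSemiring A] [CommSemiring K] {f : A →+* K}
    (hf : Function.Injective f) {g h : ι → A} {a : K} (ha : ∀ i, f (g i) = a * f (h i))
    {i₀ : ι} (hi₀ : IsUnit (h i₀)) : ∃ c, ∀ i, g i = c * h i := by
  obtain ⟨v, hv⟩ := hi₀.exists_right_inv
  have hac : f (g i₀ * v) = a := by rw [map_mul, ha, mul_assoc, ← map_mul, hv, map_one, mul_one]
  exact ⟨g i₀ * v, fun i => hf (by rw [ha, map_mul, hac])⟩

theorem derivation_apply_mem_span {k B : Type*} [CommRing k] [CommRing B] [Algebra k B]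
    (θ : Derivation k B B) {s : Set B} (hs : ∀ y ∈ s, θ y ∈ Ideal.span s) {z : B}
    (hz : z ∈ Ideal.span s) : θ z ∈ Ideal.span s := by
  induction hz using Submodule.span_induction with
  | mem y hy => exact hs y hy
  | zero => simp
  | add z w _ _ hz hw => rw [map_add]; exact add_mem hz hw
  | smul b z hz hθz =>
    rw [smul_eq_mul, θ.leibniz]
    exact add_mem (Ideal.mul_mem_left _ _ hθz) (Ideal.mul_mem_right _ _ hz)

theorem span_range_le_of_dvd_sub {ι B : Type*} [CommRing B] {x y : ι → B} {i₀ : ι}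
    (h : ∀ i, x i₀ ∣ y i - x i) : Ideal.span (Set.range y) ≤ Ideal.span (Set.range x) := by
  rw [Ideal.span_le]
  rintro _ ⟨i, rfl⟩
  have hx : ∀ j, x j ∈ Ideal.span (Set.range x) := fun j => Ideal.subset_span ⟨j, rfl⟩
  exact (Submodule.sub_mem_iff_left _ (hx i)).1 (Ideal.mem_of_dvd _ (h i) (hx i₀))

theorem exists_isRegularSystemOfParameters {B : Type*} [CommRing B] [IsRegularLocalRing B] {d : ℕ}
    (hdim : ringKrullDim B = d) : ∃ y : Fin d → B, IsRegularSystemOfParameters y := by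
  have hfg : Submodule.FG (maximalIdeal B) := (maximalIdeal B).fg_of_isNoetherianRing
  have hcard : Nat.card (Submodule.generators (maximalIdeal B)) = d := by
    have h := IsRegularLocalRing.spanFinrank_maximalIdeal (R := B)
    rw [hdim, ← hfg.generators_ncard] at h
    exact_mod_cast h
  have := hfg.finite_generators.to_subtype
  refine ⟨Subtype.val ∘ (Finite.equivFinOfCardEq hcard).symm, hdim, ?_⟩
  rw [EquivLike.range_comp, Subtype.range_coe]
  exact (maximalIdeal B).span_generators

namespace IsRegularSystemOfParameters

variable {B : Type*} [CommRing B] [IsLocalRing B] {d : ℕ} {x y : Fin d → B}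

theorem mem_maximalIdeal (hy : IsRegularSystemOfParameters y) (i : Fin d) :
    y i ∈ maximalIdeal B :=
  hy.span_range_eq ▸ Ideal.subset_span ⟨i, rfl⟩

theorem comp_perm (hy : IsRegularSystemOfParameters y) (e : Equiv.Perm (Fin d)) :
    IsRegularSystemOfParameters (y ∘ e) :=
  ⟨hy.ringKrullDim_eq, by rw [EquivLike.range_comp, hy.span_range_eq]⟩

theorem of_dvd_sub (hy : IsRegularSystemOfParameters y) {i₀ : Fin d}
    (hxy : Associated (x i₀) (y i₀)) (h : ∀ i ≠ i₀, y i₀ ∣ y i - x i) :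
    IsRegularSystemOfParameters x := by
  have hdvd : ∀ i, y i₀ ∣ x i - y i := fun i => by
    obtain rfl | hi := eq_or_ne i i₀
    · exact dvd_sub hxy.symm.dvd dvd_rfl
    · exact dvd_sub_comm.1 (h i hi)
  refine ⟨hy.ringKrullDim_eq, (le_antisymm ?_ ?_).trans hy.span_range_eq⟩
  · exact span_range_le_of_dvd_sub hdvd
  · exact span_range_le_of_dvd_sub fun i => dvd_sub_comm.1 (hxy.dvd.trans (hdvd i))

theorem exists_isUnit_derivation {k : Type*} [CommRing k] [Algebra k B]
    (hy : IsRegularSystemOfParameters y) {θ : Derivation k B B}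
    (hθ : ∃ z ∈ maximalIdeal B, IsUnit (θ z)) : ∃ i, IsUnit (θ (y i)) := by
  by_contra! h
  obtain ⟨z, hz, hθz⟩ := hθ
  refine (IsLocalRing.mem_maximalIdeal _).1 ?_ hθz
  rw [← hy.span_range_eq] at hz ⊢
  refine derivation_apply_mem_span θ ?_ hz
  rintro _ ⟨i, rfl⟩
  rw [hy.span_range_eq]
  exact h i

end IsRegularSystemOfParameters

theorem exists_isUnit_of_derivCotangentSpace_ne_zero {k B : Type*} [Field k] [CommRing B]
    [IsLocalRing B] [Algebra k B] {θ : Derivation k B B} (hθ : derivCotangentSpace θ ≠ 0) :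
    ∃ z ∈ maximalIdeal B, IsUnit (θ z) := by
  obtain ⟨t, ht⟩ := DFunLike.ne_iff.1 hθ
  obtain ⟨⟨z, hz⟩, rfl⟩ := (maximalIdeal B).toCotangent_surjective t
  exact ⟨z, hz, (residue_ne_zero_iff_isUnit _).1 ht⟩

theorem derivation_mul_sub_one_mem {k B : Type*} [CommRing k] [CommRing B] [Algebra k B]
    (θ : Derivation k B B) {I : Ideal B} {v y : B} (hy : y ∈ I) (hv : v * θ y = 1) :
    θ (v * y) - 1 ∈ I := by
  rw [θ.leibniz, smul_eq_mul, hv, add_sub_cancel_left]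
  exact I.mul_mem_right _ hy

theorem lemma2p1_general {k B : Type*} [CommRing k] [CommRing B] [IsRegularLocalRing B]
    [Algebra k B] (p : ℕ) [Fact p.Prime] [CharP B p] (d : ℕ) (hd : 1 ≤ d)
    (hdim : ringKrullDim B = d) (θ : Derivation k B B)
    (hθ : ∃ z ∈ maximalIdeal B, IsUnit (θ z)) (a : FractionRing B)
    (ha : ∀ b : B, algebraMap B (FractionRing B) (θ^[p] b) =
      a * algebraMap B (FractionRing B) (θ b)) :
    ∃ x : Fin d → B, IsRegularSystemOfParameters x ∧
      θ (x ⟨0, hd⟩) - 1 ∈ maximalIdeal B ∧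
      ∀ i : Fin d, i ≠ ⟨0, hd⟩ → θ (x i) = 0 := by
  have hp : p.Prime := Fact.out
  have hfac : IsUnit ((p - 1).factorial : B) :=
    (IsUnit.natCast_factorial_iff_of_charP p).2 (Nat.sub_lt hp.pos one_pos)
  obtain ⟨y', hy'⟩ := exists_isRegularSystemOfParameters hdim
  obtain ⟨j, hj⟩ := hy'.exists_isUnit_derivation hθ
  set y := y' ∘ Equiv.swap ⟨0, hd⟩ j
  have hy : IsRegularSystemOfParameters y := hy'.comp_perm _
  have hy₀ : IsUnit (θ (y ⟨0, hd⟩)) := by simpa [y] using hj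
  obtain ⟨v, hv⟩ := hy₀.exists_left_inv
  obtain ⟨c, hc⟩ := exists_eq_mul_of_map_eq_mul (IsFractionRing.injective B (FractionRing B)) ha hy₀
  choose z hθz hyz using exists_apply_eq_zero_dvd_sub_of_iterate_eq_mul hy₀ hp.one_lt hfac hc
  refine ⟨Function.update (z ∘ y) ⟨0, hd⟩ (v * y ⟨0, hd⟩),
    hy.of_dvd_sub (i₀ := ⟨0, hd⟩) ?_ ?_, ?_, ?_⟩
  · rw [Function.update_self]
    exact associated_unit_mul_left _ _ (.of_mul_eq_one _ hv)
  · intro i hi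
    rw [Function.update_of_ne hi]
    exact hyz (y i)
  · rw [Function.update_self]
    exact derivation_mul_sub_one_mem θ (hy.mem_maximalIdeal _) hv
  · intro i hi
    rw [Function.update_of_ne hi]
    exact hθz (y i)

theorem lemma2p1 {k B : Type*} [Field k] [CommRing B] [IsRegularLocalRing B] [Algebra k B]
    -- `B` is complete
    [IsAdicComplete (maximalIdeal B) B]
    -- `B` has prime characteristic `p`
    (p : ℕ) [Fact p.Prime] [CharP B p]
    -- `k` is the residue field of `B`, embedded in `B` as a coefficient field
    (hk : Function.Bijective (algebraMap k (ResidueField B)))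
    (d : ℕ) (hd : 1 ≤ d) (hdim : ringKrullDim B = d)
    (θ : Derivation k B B)
    (hθ : derivCotangentSpace θ ≠ 0)
    (a : FractionRing B)
    (ha : ∀ b : B, algebraMap B (FractionRing B) (θ^[p] b) =
      a * algebraMap B (FractionRing B) (θ b)) :
    ∃ x : Fin d → B, IsRegularSystemOfParameters x ∧
      θ (x ⟨0, hd⟩) - 1 ∈ maximalIdeal B ∧
      ∀ i : Fin d, i ≠ ⟨0, hd⟩ → θ (x i) = 0 :=
  lemma2p1_general p d hd hdim θ (exists_isUnit_of_derivCotangentSpace_ne_zero hθ) a ha
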